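/- Fix $R_0>0$. For $\rho_0>0$ let $\partial D$ be the ellipse $\rho=\rho_0$ in the elliptic coordinates $x_1=R_0\cos\omega\cosh\rho$, $x_2=R_0\sin\omega\sinh\rho$, with vertices $x_*$ ($\omega=0$) and $x_\circ$ ($\omega=\pi$) on the major axis. Put $\Xi=R_0\sqrt{\sinh^2\rho_0+\sin^2\omega}$ and, for $n\ge1$, define on $\partial D$ $$\phi_{1,n}=\Xi^{-1}\cos n\omega,\qquad \phi_{2,n}=\Xi^{-1}\sin n\omega .$$ For a density $\varphi$ on $\partial D$ let $$S_{\partial D}[\varphi](x)=\frac1{2\pi}\int_{\partial D}\ln|x-y|\,\varphi(y)\,ds(y)\ \ (x\in\mathbb R^2),\qquad K_{\partial D}^*[\varphi](x)=\frac1{2\pi}\int_{\partial D}\frac{\langle x-y,\nu_x\rangle}{|x-y|^2}\,\varphi(y)\,ds(y)\ \ (x\in\partial D),$$ where $\nu$ is the outward unit normal, and let $d\psi$ denote the derivative of $\psi$ along $\partial D$ with respect to arc length. The functions $\phi_{1,n},\phi_{2,n}$ are Neumann–Poincaré eigenfunctions: $K_{\partial D}^*[\phi_{1,n}]=a_n\phi_{1,n}$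 and $K_{\partial D}^*[\phi_{2,n}]=-a_n\phi_{2,n}$ with $a_n=\tfrac12e^{-2n\rho_0}$. The largest curvature of $\partial D$ is attained at $x_\circ$ and $x_*$ and equals $\kappa_{\max}=\dfrac{\cosh\rho_0}{R_0\sinh^2\rho_0}$. With $R_0$ fixed and $\rho_0$ varying in $(0,\infty)$, $\kappa_{\max}\to+\infty$ is equivalent to $\rho_0\to0^+$. For every $\rho_0>0$ and $n\ge 1$ the following hold. 1. $|\phi_{1,n}|$ attains its maximum over $\partial D$ at $x_\circ$ and at $x_*$, with $$|\phi_{1,n}(x_\circ)|=|\phi_{1,n}(x_*)|=\tau_{\max}:=\frac{1}{R_0\sinh\rho_0}.$$ There is a constant $\alpha>0$ (depending only on $R_0$) such that $\tau_{\max}\sim\alpha\,\kappa_{\max}^{1/2}$, i.e. the ratio of the two sides tends to $1$, as $\kappa_{\max}\to+\infty$. 2. $\phi_{2,n}$ is differentiable along $\partial D$, and $|d\phi_{2,n}|$ attains its maximum over $\partial D$ at $x_\circ$ and at $x_*$, with $$|d\phi_{2,n}(x_\circ)|=|d\phi_{2,n}(x_*)|=\tau_{\max}':=\frac{n}{R_0^2\sinh^2\rho_0}.$$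 For each fixed $n$, $\tau'_{\max}\to\infty$ as $\kappa_{\max}\to+\infty$. 3. The integrals defining $S_{\partial D}[\phi_{1,n}]$ and $S_{\partial D}[\phi_{2,n}]$ converge absolutely at every point of $\mathbb R^2$. $|S_{\partial D}[\phi_{1,n}]|$ attains its maximum over $\mathbb R^2$ (in particular over $\partial D$) at $x_\circ$ and at $x_*$. $S_{\partial D}[\phi_{2,n}]$ is differentiable along $\partial D$, and $|dS_{\partial D}[\phi_{2,n}]|$ attains its maximum over $\partial D$ at $x_\circ$ and at $x_*$. -/

import Mathlib

open Real Set Filter Topology MeasureTheory Asymptotics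

noncomputable section

namespace EllipseNP

/-- The Euclidean plane. -/
abbrev Plane : Type := EuclideanSpace ℝ (Fin 2)

/-! ### Closed plane curves and layer potentials

A closed curve is given by a `2π`-periodic parametrization `γ : ℝ → Plane`; one period is
`[0, 2π]`, and `ds = ‖γ' t‖ dt`. -/

/-- `∫_γ f ds`. -/
def curveIntegral (γ : ℝ → Plane) (f : Plane → ℝ) : ℝ :=
  ∫ t in (0 : ℝ)..(2 * π), f (γ t) * ‖deriv γ t‖

/-- `f` is integrable along `γ` with respect to arc length. -/
def CurveIntegrable (γ : ℝ → Plane) (f : Plane → ℝ) : Prop :=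
  IntervalIntegrable (fun t => f (γ t) * ‖deriv γ t‖) volume 0 (2 * π)

/-- The unit normal at `γ t`, pointing to the right of the direction of travel (so it is the
outward normal when `γ` runs counterclockwise). -/
def unitNormal (γ : ℝ → Plane) (t : ℝ) : Plane :=
  ‖deriv γ t‖⁻¹ • !₂[(deriv γ t) 1, -(deriv γ t) 0]

/-- The signed curvature of `γ` at `γ t` (positive for convex curves run counterclockwise). -/
def curvature (γ : ℝ → Plane) (t : ℝ) : ℝ :=
  ((deriv γ t) 0 * (deriv (deriv γ) t) 1 - (deriv γ t) 1 * (deriv (deriv γ) t) 0)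
    / ‖deriv γ t‖ ^ 3

/-- The derivative of `ψ` along the curve with respect to arc length, at `γ t`. -/
def tangentialDeriv (γ : ℝ → Plane) (ψ : Plane → ℝ) (t : ℝ) : ℝ :=
  deriv (fun s => ψ (γ s)) t / ‖deriv γ t‖

/-- The fundamental solution of the Laplacian in the plane. -/
def fundamentalSolution (x : Plane) : ℝ := 1 / (2 * π) * Real.log ‖x‖

/-- The integrand `y ↦ G(x - y) φ(y)` of the single-layer potential. -/
def singleLayerIntegrand (φ : Plane → ℝ) (x y : Plane) : ℝ :=
  fundamentalSolution (x - y) * φ y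

/-- The single-layer potential with density `φ`, as a function on the whole plane. -/
def singleLayer (γ : ℝ → Plane) (φ : Plane → ℝ) (x : Plane) : ℝ :=
  curveIntegral γ (singleLayerIntegrand φ x)

/-- The integrand `y ↦ ⟨x - y, ν_x⟩ / |x - y|² φ(y)` of the Neumann–Poincaré operator at
`x = γ t`. -/
def npIntegrand (γ : ℝ → Plane) (φ : Plane → ℝ) (t : ℝ) (y : Plane) : ℝ :=
  inner ℝ (γ t - y) (unitNormal γ t) / ‖γ t - y‖ ^ 2 * φ y

/-- The Neumann–Poincaré operator applied to `φ`, evaluated at the point `γ t`. -/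
def npOperator (γ : ℝ → Plane) (φ : Plane → ℝ) (t : ℝ) : ℝ :=
  1 / (2 * π) * curveIntegral γ (npIntegrand γ φ t)

/-- `φ`, as a function on the curve, satisfies `K*[φ] = lam φ`, all integrals being absolutely
convergent. -/
def NPEigenEquation (γ : ℝ → Plane) (φ : Plane → ℝ) (lam : ℝ) : Prop :=
  ∀ t : ℝ, CurveIntegrable γ (npIntegrand γ φ t) ∧ npOperator γ φ t = lam * φ (γ t)

/-! ### The ellipse -/

/-- The point with elliptic coordinates `(ρ, ω)`. For fixed `ρ₀ > 0`, `ellipticPoint R₀ ρ₀` is the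
counterclockwise parametrization of the ellipse `ρ = ρ₀` by `ω`. -/
def ellipticPoint (R₀ ρ ω : ℝ) : Plane :=
  !₂[R₀ * cos ω * cosh ρ, R₀ * sin ω * sinh ρ]

/-- The ellipse `ρ = ρ₀`. -/
def ellipse (R₀ ρ₀ : ℝ) : Set Plane :=
  {x | ∃ ω : ℝ, 0 ≤ ω ∧ ω ≤ 2 * π ∧ x = ellipticPoint R₀ ρ₀ ω}

/-- The right vertex on the major axis, `ω = 0`. -/
def rightVertex (R₀ ρ₀ : ℝ) : Plane := ellipticPoint R₀ ρ₀ 0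

/-- The left vertex on the major axis, `ω = π`. -/
def leftVertex (R₀ ρ₀ : ℝ) : Plane := ellipticPoint R₀ ρ₀ π

/-- The coordinate `ω ∈ (-π, π]` of a point of the ellipse `ρ = ρ₀`; there
`cos ω = x₁ / (R₀ cosh ρ₀)` and `sin ω = x₂ / (R₀ sinh ρ₀)`. -/
def ellipticAngle (R₀ ρ₀ : ℝ) (x : Plane) : ℝ :=
  Complex.arg ⟨x 0 / (R₀ * cosh ρ₀), x 1 / (R₀ * sinh ρ₀)⟩

/-- `Ξ` as a function of `ω`. -/
def Xi (R₀ ρ₀ ω : ℝ) : ℝ := R₀ * √(sinh ρ₀ ^ 2 + sin ω ^ 2)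

/-- `φ_{1,n} = Ξ⁻¹ cos nω`, as a function of the point of the ellipse. -/
def phi1 (R₀ ρ₀ : ℝ) (n : ℕ) (x : Plane) : ℝ :=
  (Xi R₀ ρ₀ (ellipticAngle R₀ ρ₀ x))⁻¹ * cos (n * ellipticAngle R₀ ρ₀ x)

/-- `φ_{2,n} = Ξ⁻¹ sin nω`, as a function of the point of the ellipse. -/
def phi2 (R₀ ρ₀ : ℝ) (n : ℕ) (x : Plane) : ℝ :=
  (Xi R₀ ρ₀ (ellipticAngle R₀ ρ₀ x))⁻¹ * sin (n * ellipticAngle R₀ ρ₀ x)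

/-- The largest curvature of the ellipse `ρ = ρ₀`. -/
def kappaMax (R₀ ρ₀ : ℝ) : ℝ := ⨆ ω : ℝ, curvature (ellipticPoint R₀ ρ₀) ω

/-- `τ_max`. -/
def tauMax (R₀ ρ₀ : ℝ) : ℝ := 1 / (R₀ * sinh ρ₀)

/-- `τ'_max`. -/
def tauMax' (R₀ ρ₀ : ℝ) (n : ℕ) : ℝ := n / (R₀ ^ 2 * sinh ρ₀ ^ 2)

/-- The limit `κ_max → +∞` for ellipses with fixed `R₀`, as a filter on the parameter
`ρ₀ ∈ (0, ∞)`. -/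
def highCurvature (R₀ : ℝ) : Filter ℝ := comap (kappaMax R₀) atTop ⊓ 𝓟 (Ioi 0)

/-! ### The definitions of the angle and of the densities agree with the coordinates -/

theorem ellipticAngle_ellipticPoint {R₀ ρ₀ : ℝ} (hR : 0 < R₀) (hρ : 0 < ρ₀) (ω : ℝ) :
    ∃ k : ℤ, ellipticAngle R₀ ρ₀ (ellipticPoint R₀ ρ₀ ω) = ω + k * (2 * π) := by
  have hs : sinh ρ₀ ≠ 0 := (Real.sinh_pos_iff.2 hρ).ne'
  have hc : cosh ρ₀ ≠ 0 := (Real.cosh_pos ρ₀).ne'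
  have h : ellipticAngle R₀ ρ₀ (ellipticPoint R₀ ρ₀ ω) =
      Complex.arg (Complex.exp (ω * Complex.I)) := by
    unfold ellipticAngle ellipticPoint
    congr 1
    apply Complex.ext
    · simp [Complex.exp_ofReal_mul_I_re]
      field_simp
    · simp [Complex.exp_ofReal_mul_I_im]
      field_simp
  rw [h, Complex.arg_exp_mul_I]
  refine ⟨-toIocDiv Real.two_pi_pos (-π) ω, ?_⟩
  rw [toIocMod, zsmul_eq_mul]
  push_cast
  ring

theorem Xi_add_int (R₀ ρ₀ ω : ℝ) (k : ℤ) : Xi R₀ ρ₀ (ω + k * (2 * π)) = Xi R₀ ρ₀ ω := by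
  simp [Xi, Real.sin_add_int_mul_two_pi]

theorem phi1_ellipticPoint {R₀ ρ₀ : ℝ} (hR : 0 < R₀) (hρ : 0 < ρ₀) (n : ℕ) (ω : ℝ) :
    phi1 R₀ ρ₀ n (ellipticPoint R₀ ρ₀ ω) = (Xi R₀ ρ₀ ω)⁻¹ * cos (n * ω) := by
  obtain ⟨k, hk⟩ := ellipticAngle_ellipticPoint hR hρ ω
  have h : (n : ℝ) * (ω + k * (2 * π)) = n * ω + ((n * k : ℤ) : ℝ) * (2 * π) := by
    push_cast
    ring
  rw [phi1, hk, Xi_add_int, h, Real.cos_add_int_mul_two_pi]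

theorem phi2_ellipticPoint {R₀ ρ₀ : ℝ} (hR : 0 < R₀) (hρ : 0 < ρ₀) (n : ℕ) (ω : ℝ) :
    phi2 R₀ ρ₀ n (ellipticPoint R₀ ρ₀ ω) = (Xi R₀ ρ₀ ω)⁻¹ * sin (n * ω) := by
  obtain ⟨k, hk⟩ := ellipticAngle_ellipticPoint hR hρ ω
  have h : (n : ℝ) * (ω + k * (2 * π)) = n * ω + ((n * k : ℤ) : ℝ) * (2 * π) := by
    push_cast
    ring
  rw [phi2, hk, Xi_add_int, h, Real.sin_add_int_mul_two_pi]

end EllipseNP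

end

namespace EllipseNP

/-! ### Fourier coefficients of `log (cosh σ - cos θ)` and of the Poisson kernel -/

/-! In elliptic coordinates everything becomes a Fourier coefficient. With source `θ` on the ellipse
`ρ = ρ₀` and target `(ρ, ω)`, the squared distance factors as `R₀² (cosh (ρ - ρ₀) - cos (θ - ω))
(cosh (ρ + ρ₀) - cos (θ + ω))` (`norm_ellipticPoint_sub_sq`), and `ds = Ξ dθ` cancels the `Ξ⁻¹` in
the densities. Both families are handled at once as `Ξ⁻¹ cos (nθ - δ)`, with `δ = 0` or `δ = π / 2`.

For `K*` the singular factor `1 - cos (θ - ω)` cancels against the normal component, which leaves a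
Poisson kernel with parameter `2ρ₀` (`npEigenEquation_of_eq`). For the single layer, the logarithm
splits into two terms with known cosine series, so the potential is explicit on the whole plane
(`singleLayer_ellipticPoint`).

The extremal claims then rest on two facts: `Ξ` takes its least value `R₀ sinh ρ₀` where `sin ω =
0`, and there `|cos nω| = 1`. The derivative of `φ_{2,n}` also needs `|sin nω| ≤ n |sin ω|`, and the
maximum over the plane needs monotonicity in `ρ` on each side of `ρ₀`. The asymptotics follow from
the closed form of `κ_max`. -/

theorem integral_cos_int_mul_add (m : ℤ) (hm : m ≠ 0) (b : ℝ) :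
    ∫ θ in (0 : ℝ)..(2 * π), cos (m * θ + b) = 0 := by
  have hm' : (m : ℝ) ≠ 0 := Int.cast_ne_zero.2 hm
  rw [intervalIntegral.integral_comp_mul_add (f := cos) hm' b, integral_cos]
  have : (m : ℝ) * (2 * π) + b = b + m * (2 * π) := by ring
  rw [this, Real.sin_add_int_mul_two_pi]
  simp

theorem integral_cos_mul_cos_phase (k n : ℕ) (hn : 1 ≤ n) (ω δ : ℝ) :
    ∫ θ in (0 : ℝ)..(2 * π), cos (k * (θ - ω)) * cos (n * θ - δ) =
      if k = n then π * cos (n * ω - δ) else 0 := by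
  have h : ∀ θ : ℝ, cos (k * (θ - ω)) * cos (n * θ - δ) =
      1 / 2 * cos (((k - n : ℤ) : ℝ) * θ + (δ - k * ω)) +
        1 / 2 * cos (((k + n : ℤ) : ℝ) * θ + (-δ - k * ω)) := by
    intro θ
    have e1 : ((k - n : ℤ) : ℝ) * θ + (δ - k * ω) = k * (θ - ω) - (n * θ - δ) := by
      push_cast; ring
    have e2 : ((k + n : ℤ) : ℝ) * θ + (-δ - k * ω) = k * (θ - ω) + (n * θ - δ) := by
      push_cast; ring
    rw [e1, e2, Real.cos_sub (k * (θ - ω)) (n * θ - δ), Real.cos_add (k * (θ - ω)) (n * θ - δ)]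
    ring
  simp_rw [h]
  rw [intervalIntegral.integral_add (Continuous.intervalIntegrable (by fun_prop) _ _)
      (Continuous.intervalIntegrable (by fun_prop) _ _),
    intervalIntegral.integral_const_mul, intervalIntegral.integral_const_mul,
    -- Since `n ≥ 1`, the sum frequency never vanishes, even for `k = 0`; only the difference
    -- frequency can contribute.
    integral_cos_int_mul_add (k + n) (by omega)]
  split_ifs with hk
  · subst hk
    have : δ - k * ω = -(k * ω - δ) := by ring
    simp [this, Real.cos_neg, -neg_sub]
    ring
  · rw [integral_cos_int_mul_add (k - n) (by omega)]
    simp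

/-- The Fourier coefficients of the sum of an absolutely convergent cosine series. -/
theorem integral_mul_cos_of_hasSum {c : ℕ → ℝ} (hc : Summable fun k => |c k|) {f : ℝ → ℝ} {ω : ℝ}
    (hf : ∀ θ, HasSum (fun k : ℕ => c k * cos (k * (θ - ω))) (f θ)) (n : ℕ) (hn : 1 ≤ n) (δ : ℝ) :
    ∫ θ in (0 : ℝ)..(2 * π), f θ * cos (n * θ - δ) = c n * (π * cos (n * ω - δ)) := by
  have key : HasSum (fun k : ℕ => ∫ θ in (0 : ℝ)..(2 * π),
      c k * cos (k * (θ - ω)) * cos (n * θ - δ))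
      (∫ θ in (0 : ℝ)..(2 * π), f θ * cos (n * θ - δ)) := by
    refine intervalIntegral.hasSum_integral_of_dominated_convergence (fun k _ => |c k|) ?_ ?_ ?_ ?_ ?_
    · intro k
      exact Continuous.aestronglyMeasurable (by fun_prop)
    · intro k
      refine Eventually.of_forall fun θ _ => ?_
      rw [norm_mul, norm_mul, Real.norm_eq_abs, Real.norm_eq_abs, Real.norm_eq_abs]
      have h1 := Real.abs_cos_le_one (k * (θ - ω))
      have h2 := Real.abs_cos_le_one (n * θ - δ)
      have h3 := abs_nonneg (c k)
      calc |c k| * |cos (k * (θ - ω))| * |cos (n * θ - δ)| ≤ |c k| * 1 * 1 := by gcongr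
        _ = |c k| := by ring
    · exact Eventually.of_forall fun _ _ => hc
    · simp
    · exact Eventually.of_forall fun θ _ => (hf θ).mul_right _
  simp_rw [mul_assoc, intervalIntegral.integral_const_mul, integral_cos_mul_cos_phase _ n hn] at key
  refine key.unique ?_
  convert hasSum_ite_eq n (c n * (π * cos (n * ω - δ))) using 2 with k
  split_ifs with h <;> simp [h]

theorem cosh_sub_cos_pos {σ : ℝ} (hσ : σ ≠ 0) (u : ℝ) : 0 < cosh σ - cos u := by
  have := Real.one_lt_cosh.2 hσ
  linarith [Real.cos_le_one u]

theorem exp_neg_add_pow_re (σ u : ℝ) (k : ℕ) :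
    (Complex.exp (-σ + u * Complex.I) ^ k).re = exp (-(k * σ)) * cos (k * u) := by
  rw [← Complex.exp_nat_mul, Complex.exp_re]
  simp

theorem one_sub_exp_re (σ u : ℝ) :
    (1 - Complex.exp (-σ + u * Complex.I)).re = 1 - exp (-σ) * cos u := by
  simp [Complex.exp_re]

theorem normSq_one_sub_exp (σ u : ℝ) :
    Complex.normSq (1 - Complex.exp (-σ + u * Complex.I)) =
      2 * exp (-σ) * (cosh σ - cos u) := by
  rw [Complex.normSq_apply]
  have h : exp (-σ) * exp σ = 1 := by rw [← Real.exp_add]; simp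
  simp only [Complex.sub_re, Complex.sub_im, Complex.one_re, Complex.one_im, Complex.exp_re,
    Complex.exp_im, Complex.add_re, Complex.add_im, Complex.neg_re, Complex.neg_im,
    Complex.ofReal_re, Complex.ofReal_im, Complex.mul_re, Complex.mul_im, Complex.I_re,
    Complex.I_im, mul_zero, mul_one, sub_zero, add_zero, neg_zero, zero_add, Real.cosh_eq]
  linear_combination (exp (-σ)) ^ 2 * Real.sin_sq_add_cos_sq u - h

theorem norm_exp_neg_add_lt_one {σ : ℝ} (hσ : 0 < σ) (u : ℝ) :
    ‖Complex.exp (-σ + u * Complex.I)‖ < 1 := by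
  rw [Complex.norm_exp]
  simpa using hσ

/-- Real part of the series of `-log (1 - z)` at `z = exp (-σ + iu)`, where `|1 - z|² = 2 exp (-σ)
(cosh σ - cos u)`. At `k = 0` the quotient by `k` is `0` by convention, so the constant term is
supplied separately. -/
theorem hasSum_log_cosh_sub_cos {σ : ℝ} (hσ : 0 < σ) (u : ℝ) :
    HasSum (fun k : ℕ => ((if k = 0 then σ - log 2 else 0) - 2 * exp (-(k * σ)) / k) * cos (k * u))
      (log (cosh σ - cos u)) := by
  have h := Complex.hasSum_re (Complex.hasSum_taylorSeries_neg_log (norm_exp_neg_add_lt_one hσ u))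
  have hre : (-Complex.log (1 - Complex.exp (-σ + u * Complex.I))).re =
      -(1 / 2) * (log 2 - σ + log (cosh σ - cos u)) := by
    have hp := cosh_sub_cos_pos hσ.ne' u
    rw [Complex.neg_re, Complex.log_re, Complex.norm_def, normSq_one_sub_exp, Real.log_sqrt
      (by positivity), Real.log_mul (by positivity) hp.ne', Real.log_mul (by norm_num)
      (Real.exp_ne_zero _), Real.log_exp]
    ring
  rw [hre] at h
  convert (hasSum_ite_eq 0 (σ - log 2)).add (h.mul_left (-2)) using 1
  · ext k
    have : (Complex.exp (-σ + u * Complex.I) ^ k / k).re = exp (-(k * σ)) * cos (k * u) / k := by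
      rw [Complex.div_natCast_re, exp_neg_add_pow_re]
    rw [this]
    split_ifs with hk
    · simp [hk]
    · ring
  · ring

/-- Real part of the geometric series at the same `z`: the Poisson kernel is `2 Re (1 - z)⁻¹ - 1`.
-/
theorem hasSum_poisson {σ : ℝ} (hσ : 0 < σ) (u : ℝ) :
    HasSum (fun k : ℕ => ((if k = 0 then -1 else 0) + 2 * exp (-(k * σ))) * cos (k * u))
      (sinh σ / (cosh σ - cos u)) := by
  have h := Complex.hasSum_re (hasSum_geometric_of_norm_lt_one (norm_exp_neg_add_lt_one hσ u))
  have hp := cosh_sub_cos_pos hσ.ne' u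
  have h1 : exp (-σ) * exp σ = 1 := by rw [← Real.exp_add]; simp
  have hre : ((1 - Complex.exp (-σ + u * Complex.I))⁻¹).re =
      (1 / 2) * (1 + sinh σ / (cosh σ - cos u)) := by
    rw [Complex.inv_re, normSq_one_sub_exp, one_sub_exp_re]
    have he := Real.exp_pos (-σ)
    field_simp
    rw [Real.cosh_eq, Real.sinh_eq]
    linear_combination -h1
  rw [hre] at h
  convert (hasSum_ite_eq 0 (-1 : ℝ)).add (h.mul_left 2) using 1
  · ext k
    rw [exp_neg_add_pow_re]
    split_ifs with hk
    · simp [hk]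
    · ring
  · ring

theorem summable_exp_neg_nat_mul {σ : ℝ} (hσ : 0 < σ) :
    Summable fun k : ℕ => exp (-(k * σ)) := by
  have := summable_geometric_of_lt_one (Real.exp_pos (-σ)).le (Real.exp_lt_one_iff.2 (neg_neg_of_pos hσ))
  refine this.congr fun k => ?_
  rw [← Real.exp_nat_mul]
  ring_nf

theorem integral_poisson_mul_cos {σ : ℝ} (hσ : 0 < σ) (ω : ℝ) (n : ℕ) (hn : 1 ≤ n) (δ : ℝ) :
    ∫ θ in (0 : ℝ)..(2 * π), sinh σ / (cosh σ - cos (θ - ω)) * cos (n * θ - δ) =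
      2 * π * exp (-(n * σ)) * cos (n * ω - δ) := by
  rw [integral_mul_cos_of_hasSum ?_ (fun θ => hasSum_poisson hσ (θ - ω)) n hn δ,
    if_neg (by omega)]
  · ring
  · exact ((hasSum_ite_eq 0 (-1 : ℝ)).summable.add
      ((summable_exp_neg_nat_mul hσ).mul_left 2)).abs

theorem integral_log_mul_cos_of_pos {σ : ℝ} (hσ : 0 < σ) (ω : ℝ) (n : ℕ) (hn : 1 ≤ n) (δ : ℝ) :
    ∫ θ in (0 : ℝ)..(2 * π), log (cosh σ - cos (θ - ω)) * cos (n * θ - δ) =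
      -(2 * π / n) * exp (-(n * σ)) * cos (n * ω - δ) := by
  rw [integral_mul_cos_of_hasSum ?_ (fun θ => hasSum_log_cosh_sub_cos hσ (θ - ω)) n hn δ,
    if_neg (by omega)]
  · ring
  · refine ((hasSum_ite_eq 0 (σ - log 2)).summable.sub ?_).abs
    refine Summable.of_norm_bounded ((summable_exp_neg_nat_mul hσ).mul_left 2) fun k => ?_
    rw [Real.norm_eq_abs, abs_of_nonneg (by positivity)]
    rcases Nat.eq_zero_or_pos k with rfl | hk
    · simp
    · exact div_le_self (by positivity) (by exact_mod_cast hk)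

theorem intervalIntegrable_log_cosh_sub_cos (σ ω a b : ℝ) :
    IntervalIntegrable (fun θ => log (cosh σ - cos (θ - ω))) volume a b := by
  have : AnalyticOnNhd ℝ (fun θ => cosh σ - cos (θ - ω)) (uIcc a b) := fun θ _ =>
    analyticAt_const.sub (Real.analyticAt_cos.comp (analyticAt_id.sub analyticAt_const))
  exact this.meromorphicOn.intervalIntegrable_log

theorem ae_cos_sub_ne_one (ω : ℝ) : ∀ᵐ θ : ℝ, cos (θ - ω) ≠ 1 := by
  have h : {θ : ℝ | cos (θ - ω) = 1} ⊆ range fun k : ℤ => k * (2 * π) + ω := by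
    intro θ hθ
    obtain ⟨k, hk⟩ := (Real.cos_eq_one_iff _).1 hθ
    exact ⟨k, by simp only [hk]; ring⟩
  have h0 := ((countable_range fun k : ℤ => (k : ℝ) * (2 * π) + ω).mono h).measure_zero volume
  simpa [ae_iff] using h0

theorem abs_log_cosh_sub_cos_le {σ u : ℝ} (hσ : |σ| ≤ 1) (hu : cos u ≠ 1) :
    |log (cosh σ - cos u)| ≤ |log (1 - cos u)| + log (cosh 1 + 1) := by
  have h1 : 0 < 1 - cos u := by
    have := lt_of_le_of_ne (Real.cos_le_one u) hu
    linarith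
  have h2 : 1 - cos u ≤ cosh σ - cos u := by linarith [Real.one_le_cosh σ]
  have h3 : cosh σ - cos u ≤ cosh 1 + 1 := by
    have : cosh σ ≤ cosh 1 := Real.cosh_le_cosh.2 (by simpa using hσ)
    linarith [Real.neg_one_le_cos u]
  have h4 := Real.log_le_log h1 h2
  have h5 := Real.log_le_log (h1.trans_le h2) h3
  have h6 : 0 ≤ log (cosh 1 + 1) := Real.log_nonneg (by linarith [Real.one_le_cosh 1])
  have h7 := neg_abs_le (log (1 - cos u))
  have h8 := abs_nonneg (log (1 - cos u))
  exact abs_le.2 ⟨by linarith, by linarith⟩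

/-- For targets on the ellipse itself `σ = 0`, and the cosine coefficients, of order `1 / k`, are no
longer absolutely summable. The value is obtained from `σ → 0⁺` by dominated convergence, the
majorant being the integrable logarithmic singularity plus a constant. -/
theorem integral_log_one_sub_cos_mul_cos (ω : ℝ) (n : ℕ) (hn : 1 ≤ n) (δ : ℝ) :
    ∫ θ in (0 : ℝ)..(2 * π), log (cosh 0 - cos (θ - ω)) * cos (n * θ - δ) =
      -(2 * π / n) * exp (-(n * 0)) * cos (n * ω - δ) := by
  have lim1 : Tendsto (fun σ : ℝ => ∫ θ in (0 : ℝ)..(2 * π),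
      log (cosh σ - cos (θ - ω)) * cos (n * θ - δ)) (𝓝[>] 0)
      (𝓝 (∫ θ in (0 : ℝ)..(2 * π), log (cosh 0 - cos (θ - ω)) * cos (n * θ - δ))) := by
    refine intervalIntegral.tendsto_integral_filter_of_dominated_convergence
      (fun θ => |log (1 - cos (θ - ω))| + log (cosh 1 + 1)) ?_ ?_ ?_ ?_
    · refine Eventually.of_forall fun σ => Measurable.aestronglyMeasurable ?_
      fun_prop
    · have : ∀ᶠ σ : ℝ in 𝓝[>] 0, |σ| ≤ 1 := by
        filter_upwards [Ioo_mem_nhdsGT (zero_lt_one (α := ℝ))] with σ hσ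
        rw [abs_of_pos hσ.1]
        exact hσ.2.le
      filter_upwards [this] with σ hσ
      filter_upwards [ae_cos_sub_ne_one ω] with θ hθ _
      rw [norm_mul]
      exact (mul_le_of_le_one_right (norm_nonneg _) (Real.abs_cos_le_one _)).trans
        (abs_log_cosh_sub_cos_le hσ hθ)
    · have := intervalIntegrable_log_cosh_sub_cos 0 ω 0 (2 * π)
      rw [Real.cosh_zero] at this
      exact this.abs.add intervalIntegrable_const
    · filter_upwards [ae_cos_sub_ne_one ω] with θ hθ _
      have hc : ContinuousAt (fun σ : ℝ => log (cosh σ - cos (θ - ω)) * cos (n * θ - δ)) 0 := by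
        refine ContinuousAt.mul (ContinuousAt.log (by fun_prop) ?_) continuousAt_const
        rw [Real.cosh_zero, sub_ne_zero]
        exact hθ.symm
      exact hc.tendsto.mono_left nhdsWithin_le_nhds
  have lim2 : Tendsto (fun σ : ℝ => -(2 * π / n) * exp (-(n * σ)) * cos (n * ω - δ)) (𝓝[>] 0)
      (𝓝 (-(2 * π / n) * exp (-(n * 0)) * cos (n * ω - δ))) :=
    (Continuous.tendsto (by fun_prop) 0).mono_left nhdsWithin_le_nhds
  refine tendsto_nhds_unique (lim1.congr' ?_) lim2
  filter_upwards [self_mem_nhdsWithin] with σ hσ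
  exact integral_log_mul_cos_of_pos hσ ω n hn δ

theorem integral_log_mul_cos (σ ω : ℝ) (n : ℕ) (hn : 1 ≤ n) (δ : ℝ) :
    ∫ θ in (0 : ℝ)..(2 * π), log (cosh σ - cos (θ - ω)) * cos (n * θ - δ) =
      -(2 * π / n) * exp (-(n * |σ|)) * cos (n * ω - δ) := by
  rw [← Real.cosh_abs]
  rcases (abs_nonneg σ).eq_or_lt' with h | h
  · rw [h]
    exact integral_log_one_sub_cos_mul_cos ω n hn δ
  · exact integral_log_mul_cos_of_pos h ω n hn δ

/-! ### Geometry of the ellipse -/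

theorem Xi_pos {R₀ ρ₀ : ℝ} (hR : 0 < R₀) (hρ : 0 < ρ₀) (ω : ℝ) : 0 < Xi R₀ ρ₀ ω := by
  have := Real.sinh_pos_iff.2 hρ
  unfold Xi
  positivity

theorem Xi_sq (R₀ ρ₀ ω : ℝ) : Xi R₀ ρ₀ ω ^ 2 = R₀ ^ 2 * (sinh ρ₀ ^ 2 + sin ω ^ 2) := by
  rw [Xi, mul_pow, Real.sq_sqrt (by positivity)]

theorem Xi_eq_of_sin_eq_zero {R₀ ρ₀ ω : ℝ} (hρ : 0 < ρ₀) (hω : sin ω = 0) :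
    Xi R₀ ρ₀ ω = R₀ * sinh ρ₀ := by
  rw [Xi, hω, zero_pow two_ne_zero, add_zero, Real.sqrt_sq (Real.sinh_pos_iff.2 hρ).le]

theorem le_Xi {R₀ ρ₀ : ℝ} (hR : 0 < R₀) (ω : ℝ) : R₀ * sinh ρ₀ ≤ Xi R₀ ρ₀ ω :=
  mul_le_mul_of_nonneg_left (Real.le_sqrt_of_sq_le (by nlinarith [sq_nonneg (sin ω)])) hR.le

theorem abs_cos_nat_mul_of_sin_eq_zero {ω : ℝ} (hω : sin ω = 0) (n : ℕ) : |cos (n * ω)| = 1 := by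
  obtain ⟨k, rfl⟩ := Real.sin_eq_zero_iff.1 hω
  have : (n : ℝ) * (k * π) = ((n * k : ℤ) : ℝ) * π := by push_cast; ring
  rw [this, Real.abs_cos_int_mul_pi]

/-- Induction by the addition formula. This makes the term `sin nω sin ω cos ω` in the derivative of
`φ_{2,n}` comparable with `n sin² ω`. -/
theorem abs_sin_nat_mul_le (n : ℕ) (ω : ℝ) : |sin (n * ω)| ≤ n * |sin ω| := by
  induction n with
  | zero => simp
  | succ n ih =>
    have : ((n + 1 : ℕ) : ℝ) * ω = n * ω + ω := by push_cast; ring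
    rw [this, Real.sin_add]
    push_cast
    calc |sin (n * ω) * cos ω + cos (n * ω) * sin ω|
        ≤ |sin (n * ω)| * |cos ω| + |cos (n * ω)| * |sin ω| := by
          rw [← abs_mul, ← abs_mul]; exact abs_add_le _ _
      _ ≤ n * |sin ω| * 1 + 1 * |sin ω| := by
          gcongr <;> exact Real.abs_cos_le_one _
      _ = (n + 1) * |sin ω| := by ring

theorem hasDerivAt_ellipticPoint (R₀ ρ₀ ω : ℝ) :
    HasDerivAt (ellipticPoint R₀ ρ₀) !₂[-(R₀ * sin ω * cosh ρ₀), R₀ * cos ω * sinh ρ₀] ω := by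
  have h : HasDerivAt (fun ω => cos ω • (!₂[R₀ * cosh ρ₀, 0] : Plane) +
      sin ω • (!₂[0, R₀ * sinh ρ₀] : Plane)) ((-sin ω) • (!₂[R₀ * cosh ρ₀, 0] : Plane) +
      cos ω • (!₂[0, R₀ * sinh ρ₀] : Plane)) ω :=
    ((Real.hasDerivAt_cos ω).smul_const _).add ((Real.hasDerivAt_sin ω).smul_const _)
  convert h using 1
  · funext ω
    ext i
    fin_cases i <;> simp [ellipticPoint] <;> ring
  · ext i
    fin_cases i <;> simp <;> ring

theorem deriv_ellipticPoint (R₀ ρ₀ : ℝ) : deriv (ellipticPoint R₀ ρ₀) =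
    fun ω => !₂[-(R₀ * sin ω * cosh ρ₀), R₀ * cos ω * sinh ρ₀] :=
  funext fun ω => (hasDerivAt_ellipticPoint R₀ ρ₀ ω).deriv

theorem norm_deriv_ellipticPoint {R₀ : ℝ} (hR : 0 < R₀) (ρ₀ ω : ℝ) :
    ‖deriv (ellipticPoint R₀ ρ₀) ω‖ = Xi R₀ ρ₀ ω := by
  rw [deriv_ellipticPoint, EuclideanSpace.norm_eq, Xi]
  conv_rhs => rw [← Real.sqrt_sq hR.le, ← Real.sqrt_mul (sq_nonneg R₀)]
  congr 1
  simp only [Fin.sum_univ_two, Real.norm_eq_abs, sq_abs]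
  simp
  linear_combination R₀ ^ 2 * sin ω ^ 2 * Real.cosh_sq ρ₀ +
    R₀ ^ 2 * sinh ρ₀ ^ 2 * Real.sin_sq_add_cos_sq ω

theorem deriv_deriv_ellipticPoint (R₀ ρ₀ ω : ℝ) : deriv (deriv (ellipticPoint R₀ ρ₀)) ω =
    !₂[-(R₀ * cos ω * cosh ρ₀), -(R₀ * sin ω * sinh ρ₀)] := by
  -- Differentiation acts on this parametrization as a quarter-period shift, so the second
  -- derivative needs no new computation.
  have h : deriv (ellipticPoint R₀ ρ₀) = fun ω => ellipticPoint R₀ ρ₀ (ω + π / 2) := by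
    rw [deriv_ellipticPoint]
    funext ω
    simp [ellipticPoint, Real.cos_add_pi_div_two, Real.sin_add_pi_div_two]
  rw [h, deriv_comp_add_const, deriv_ellipticPoint]
  simp [Real.cos_add_pi_div_two, Real.sin_add_pi_div_two]

theorem curvature_ellipticPoint {R₀ : ℝ} (hR : 0 < R₀) (ρ₀ ω : ℝ) :
    curvature (ellipticPoint R₀ ρ₀) ω = R₀ ^ 2 * sinh ρ₀ * cosh ρ₀ / Xi R₀ ρ₀ ω ^ 3 := by
  rw [curvature, norm_deriv_ellipticPoint hR, deriv_deriv_ellipticPoint, deriv_ellipticPoint]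
  congr 1
  simp
  linear_combination R₀ ^ 2 * sinh ρ₀ * cosh ρ₀ * Real.sin_sq_add_cos_sq ω

theorem curvature_of_sin_eq_zero {R₀ ρ₀ ω : ℝ} (hR : 0 < R₀) (hρ : 0 < ρ₀) (hω : sin ω = 0) :
    curvature (ellipticPoint R₀ ρ₀) ω = cosh ρ₀ / (R₀ * sinh ρ₀ ^ 2) := by
  have hs := Real.sinh_pos_iff.2 hρ
  rw [curvature_ellipticPoint hR, Xi_eq_of_sin_eq_zero hρ hω]
  field_simp

theorem isMaxOn_curvature {R₀ ρ₀ ω : ℝ} (hR : 0 < R₀) (hρ : 0 < ρ₀) (hω : sin ω = 0) :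
    IsMaxOn (curvature (ellipticPoint R₀ ρ₀)) univ ω := by
  intro t _
  have hs := Real.sinh_pos_iff.2 hρ
  have hc := Real.cosh_pos ρ₀
  have h := le_Xi (ρ₀ := ρ₀) hR t
  change curvature (ellipticPoint R₀ ρ₀) t ≤ curvature (ellipticPoint R₀ ρ₀) ω
  rw [curvature_ellipticPoint hR, curvature_ellipticPoint hR, Xi_eq_of_sin_eq_zero hρ hω]
  gcongr

theorem curvature_eq_kappaMax {R₀ ρ₀ ω : ℝ} (hR : 0 < R₀) (hρ : 0 < ρ₀) (hω : sin ω = 0) :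
    curvature (ellipticPoint R₀ ρ₀) ω = kappaMax R₀ ρ₀ := by
  have h : ∀ t, curvature (ellipticPoint R₀ ρ₀) t ≤ curvature (ellipticPoint R₀ ρ₀) ω :=
    fun t => isMaxOn_curvature hR hρ hω (mem_univ t)
  exact le_antisymm (le_ciSup ⟨_, forall_mem_range.2 h⟩ ω) (ciSup_le h)

theorem kappaMax_eq {R₀ ρ₀ : ℝ} (hR : 0 < R₀) (hρ : 0 < ρ₀) :
    kappaMax R₀ ρ₀ = cosh ρ₀ / (R₀ * sinh ρ₀ ^ 2) := by
  rw [← curvature_eq_kappaMax hR hρ Real.sin_zero, curvature_of_sin_eq_zero hR hρ Real.sin_zero]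

/-! ### The limit of large curvature -/

theorem tendsto_sinh_nhdsGT_zero : Tendsto sinh (𝓝[>] 0) (𝓝[>] 0) := by
  refine tendsto_nhdsWithin_iff.2 ⟨?_, ?_⟩
  · have := Real.continuous_sinh.tendsto 0
    rw [Real.sinh_zero] at this
    exact this.mono_left nhdsWithin_le_nhds
  · filter_upwards [self_mem_nhdsWithin] with x hx
    exact Real.sinh_pos_iff.2 hx

theorem tendsto_const_div_mul_sinh_sq {R₀ c : ℝ} (hR : 0 < R₀) (hc : 0 < c) :
    Tendsto (fun ρ => c / (R₀ ^ 2 * sinh ρ ^ 2)) (𝓝[>] 0) atTop := by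
  have h := (tendsto_pow_atTop two_ne_zero).comp
    (tendsto_inv_nhdsGT_zero.comp tendsto_sinh_nhdsGT_zero)
  refine (h.const_mul_atTop (r := c / R₀ ^ 2) (by positivity)).congr fun ρ => ?_
  simp only [Function.comp]
  rw [inv_pow]
  ring

theorem tendsto_kappaMax {R₀ : ℝ} (hR : 0 < R₀) : Tendsto (kappaMax R₀) (𝓝[>] 0) atTop := by
  -- By `cosh ρ ≥ 1`, `κ_max` is at least `1 / (R₀ sinh² ρ)`, written here with numerator `R₀`.
  refine tendsto_atTop_mono' _ ?_ (tendsto_const_div_mul_sinh_sq hR hR)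
  filter_upwards [self_mem_nhdsWithin] with ρ hρ
  have hs := Real.sinh_pos_iff.2 (mem_Ioi.1 hρ)
  rw [kappaMax_eq hR hρ, div_le_div_iff₀ (by positivity) (by positivity)]
  nlinarith [Real.one_le_cosh ρ, show 0 < R₀ ^ 2 * sinh ρ ^ 2 by positivity]

/-- `κ_max` stays bounded away from `ρ₀ = 0`. -/
theorem kappaMax_le {R₀ ε ρ : ℝ} (hR : 0 < R₀) (hε : 0 < ε) (hρ : ε ≤ ρ) :
    kappaMax R₀ ρ ≤ (1 + 1 / sinh ε) / (R₀ * sinh ε) := by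
  have hs := Real.sinh_pos_iff.2 hε
  have hs' : sinh ε ≤ sinh ρ := Real.sinh_le_sinh.2 hρ
  have hs'' := hs.trans_le hs'
  -- From `cosh ρ - sinh ρ = exp (-ρ) ≤ 1`; the resulting bound depends on `sinh ρ` alone and
  -- decreases in it.
  have hc : cosh ρ ≤ 1 + sinh ρ := by
    have h1 : exp (-ρ) ≤ 1 := Real.exp_le_one_iff.2 (by linarith)
    rw [← Real.cosh_sub_sinh] at h1
    linarith
  calc kappaMax R₀ ρ = cosh ρ / (R₀ * sinh ρ ^ 2) := kappaMax_eq hR (hε.trans_le hρ)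
    _ ≤ (1 + sinh ρ) / (R₀ * sinh ρ ^ 2) := by gcongr
    _ = (1 + 1 / sinh ρ) / (R₀ * sinh ρ) := by field_simp; ring
    _ ≤ (1 + 1 / sinh ε) / (R₀ * sinh ε) := by gcongr

theorem highCurvature_eq {R₀ : ℝ} (hR : 0 < R₀) : highCurvature R₀ = 𝓝[>] (0 : ℝ) := by
  refine le_antisymm ?_ (le_inf (tendsto_kappaMax hR).le_comap inf_le_right)
  intro s hs
  obtain ⟨ε, hε, hs⟩ := mem_nhdsGT_iff_exists_Ioo_subset.1 hs
  have h1 : ∀ᶠ ρ in comap (kappaMax R₀) atTop,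
      (1 + 1 / sinh ε) / (R₀ * sinh ε) < kappaMax R₀ ρ :=
    tendsto_comap.eventually (eventually_gt_atTop _)
  refine mem_inf_iff_superset.2 ⟨_, h1, _, mem_principal_self _, fun ρ hρ => hs ⟨hρ.2, ?_⟩⟩
  by_contra hcon
  exact absurd (kappaMax_le hR hε (not_lt.1 hcon)) (not_le.2 hρ.1)

/-- With `α = R₀^(-1/2)` the ratio of the two sides is exactly `(cosh ρ₀)^(-1/2)`. -/
theorem tauMax_isEquivalent {R₀ : ℝ} (hR : 0 < R₀) :
    tauMax R₀ ~[𝓝[>] 0] fun ρ₀ => (√R₀)⁻¹ * kappaMax R₀ ρ₀ ^ (1 / 2 : ℝ) := by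
  have h : Tendsto (fun ρ => (√(cosh ρ))⁻¹) (𝓝[>] 0) (𝓝 1) := by
    have : ContinuousAt (fun ρ => (√(cosh ρ))⁻¹) 0 :=
      ContinuousAt.inv₀ (by fun_prop) (by simp)
    have h2 := this.tendsto.mono_left (nhdsWithin_le_nhds (s := Ioi 0))
    simpa using h2
  refine isEquivalent_iff_exists_eq_mul.2 ⟨_, h, ?_⟩
  filter_upwards [self_mem_nhdsWithin] with ρ hρ
  have hs := Real.sinh_pos_iff.2 (mem_Ioi.1 hρ)
  have hc := Real.cosh_pos ρ
  simp only [Pi.mul_apply]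
  rw [kappaMax_eq hR hρ, ← Real.sqrt_eq_rpow, Real.sqrt_div hc.le, Real.sqrt_mul hR.le,
    Real.sqrt_sq hs.le, tauMax]
  have h1 : 0 < √(cosh ρ) := Real.sqrt_pos.2 hc
  have h2 : 0 < √R₀ := Real.sqrt_pos.2 hR
  field_simp
  rw [Real.sq_sqrt hR.le]

/-! ### The Neumann–Poincaré operator and the single layer on the ellipse -/

/-- Identifying the plane with `ℂ`, the point is `R₀ cos (ω - iρ)`. The factorization is that of a
difference of cosines into two sines, together with `2 |sin ((a + ib) / 2)|² = cosh b - cos a`; the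
proof verifies it by expansion. -/
theorem norm_ellipticPoint_sub_sq (R₀ ρ ρ₀ ω θ : ℝ) :
    ‖ellipticPoint R₀ ρ ω - ellipticPoint R₀ ρ₀ θ‖ ^ 2 =
      R₀ ^ 2 * ((cosh (ρ - ρ₀) - cos (θ - ω)) * (cosh (ρ + ρ₀) - cos (θ - -ω))) := by
  rw [EuclideanSpace.norm_sq_eq, Fin.sum_univ_two, Real.norm_eq_abs, Real.norm_eq_abs, sq_abs,
    sq_abs, sub_neg_eq_add, Real.cosh_sub, Real.cosh_add, Real.cos_sub, Real.cos_add]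
  simp only [ellipticPoint, PiLp.sub_apply, Matrix.cons_val_zero, Matrix.cons_val_one,
    Matrix.cons_val_fin_one]
  have h1 := Real.sin_sq_add_cos_sq ω
  have h2 := Real.sin_sq_add_cos_sq θ
  have h3 := Real.cosh_sq ρ
  have h4 := Real.cosh_sq ρ₀
  rw [← eq_sub_iff_add_eq] at h1 h2
  have e : (R₀ * cos ω * cosh ρ - R₀ * cos θ * cosh ρ₀) ^ 2 +
      (R₀ * sin ω * sinh ρ - R₀ * sin θ * sinh ρ₀) ^ 2 =
      R₀ ^ 2 * (cos ω ^ 2 * cosh ρ ^ 2 + cos θ ^ 2 * cosh ρ₀ ^ 2 + sin ω ^ 2 * sinh ρ ^ 2 +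
        sin θ ^ 2 * sinh ρ₀ ^ 2 - 2 * cos ω * cosh ρ * cos θ * cosh ρ₀
        - 2 * sin ω * sinh ρ * sin θ * sinh ρ₀) := by ring
  have e' : (cosh ρ * cosh ρ₀ - sinh ρ * sinh ρ₀ - (cos θ * cos ω + sin θ * sin ω)) *
      (cosh ρ * cosh ρ₀ + sinh ρ * sinh ρ₀ - (cos θ * cos ω - sin θ * sin ω)) =
      cosh ρ ^ 2 * cosh ρ₀ ^ 2 - sinh ρ ^ 2 * sinh ρ₀ ^ 2 + cos θ ^ 2 * cos ω ^ 2
        - sin θ ^ 2 * sin ω ^ 2 - 2 * cos ω * cosh ρ * cos θ * cosh ρ₀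
        - 2 * sin ω * sinh ρ * sin θ * sinh ρ₀ := by ring
  rw [e, e', h1, h2, h3, h4]
  ring

theorem norm_ellipticPoint_sub_sq_of_eq (R₀ ρ₀ ω θ : ℝ) :
    ‖ellipticPoint R₀ ρ₀ ω - ellipticPoint R₀ ρ₀ θ‖ ^ 2 =
      R₀ ^ 2 * ((1 - cos (θ - ω)) * (cosh (2 * ρ₀) - cos (θ - -ω))) := by
  rw [norm_ellipticPoint_sub_sq, sub_self, Real.cosh_zero, two_mul]

theorem inner_ellipticPoint_sub_unitNormal {R₀ : ℝ} (hR : 0 < R₀) (ρ₀ ω θ : ℝ) :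
    inner ℝ (ellipticPoint R₀ ρ₀ ω - ellipticPoint R₀ ρ₀ θ)
      (unitNormal (ellipticPoint R₀ ρ₀) ω) =
      (Xi R₀ ρ₀ ω)⁻¹ * (R₀ ^ 2 * sinh ρ₀ * cosh ρ₀ * (1 - cos (θ - ω))) := by
  rw [unitNormal, norm_deriv_ellipticPoint hR, inner_smul_right, deriv_ellipticPoint]
  congr 1
  rw [Real.cos_sub, PiLp.inner_apply, Fin.sum_univ_two]
  simp [ellipticPoint]
  linear_combination R₀ ^ 2 * sinh ρ₀ * cosh ρ₀ * Real.sin_sq_add_cos_sq ω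

/-- On the ellipse the kernel of `K*` is a Poisson kernel. -/
theorem npIntegrand_mul_norm_deriv {R₀ ρ₀ : ℝ} (hR : 0 < R₀) (hρ : 0 < ρ₀) {φ : Plane → ℝ}
    {n : ℕ} {δ : ℝ}
    (hφ : ∀ t, φ (ellipticPoint R₀ ρ₀ t) = (Xi R₀ ρ₀ t)⁻¹ * cos (n * t - δ)) {ω θ : ℝ}
    (hθ : cos (θ - ω) ≠ 1) :
    npIntegrand (ellipticPoint R₀ ρ₀) φ ω (ellipticPoint R₀ ρ₀ θ) *
      ‖deriv (ellipticPoint R₀ ρ₀) θ‖ = (2 * Xi R₀ ρ₀ ω)⁻¹ *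
        (sinh (2 * ρ₀) / (cosh (2 * ρ₀) - cos (θ - -ω)) * cos (n * θ - δ)) := by
  have h1 := (Xi_pos hR hρ θ).ne'
  have h2 := (Xi_pos hR hρ ω).ne'
  have h3 : 1 - cos (θ - ω) ≠ 0 := sub_ne_zero.2 hθ.symm
  have h4 := (cosh_sub_cos_pos (σ := 2 * ρ₀) (by positivity) (θ - -ω)).ne'
  rw [npIntegrand, hφ, norm_deriv_ellipticPoint hR, inner_ellipticPoint_sub_unitNormal hR,
    norm_ellipticPoint_sub_sq_of_eq, Real.sinh_two_mul]
  field_simp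

/-- The Poisson kernel is centred at `-ω`, so `K*` damps the mode and reflects it. Even modes keep
their sign and odd modes change it, which is what `hlam` encodes. -/
theorem npEigenEquation_of_eq {R₀ ρ₀ : ℝ} (hR : 0 < R₀) (hρ : 0 < ρ₀) {φ : Plane → ℝ} {n : ℕ}
    (hn : 1 ≤ n) {δ lam : ℝ}
    (hφ : ∀ t, φ (ellipticPoint R₀ ρ₀ t) = (Xi R₀ ρ₀ t)⁻¹ * cos (n * t - δ))
    (hlam : ∀ t, 1 / 2 * exp (-(n * (2 * ρ₀))) * cos (n * -t - δ) = lam * cos (n * t - δ)) :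
    NPEigenEquation (ellipticPoint R₀ ρ₀) φ lam := by
  intro ω
  -- Equality holds only almost everywhere: at `θ = ω` the kernel is a quotient by zero, while the
  -- Poisson kernel extends continuously.
  have hae : ∀ᵐ θ : ℝ, (2 * Xi R₀ ρ₀ ω)⁻¹ *
      (sinh (2 * ρ₀) / (cosh (2 * ρ₀) - cos (θ - -ω)) * cos (n * θ - δ)) =
      npIntegrand (ellipticPoint R₀ ρ₀) φ ω (ellipticPoint R₀ ρ₀ θ) *
        ‖deriv (ellipticPoint R₀ ρ₀) θ‖ := by
    filter_upwards [ae_cos_sub_ne_one ω] with θ hθ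
    exact (npIntegrand_mul_norm_deriv hR hρ hφ hθ).symm
  have hcont : Continuous fun θ : ℝ => (2 * Xi R₀ ρ₀ ω)⁻¹ *
      (sinh (2 * ρ₀) / (cosh (2 * ρ₀) - cos (θ - -ω)) * cos (n * θ - δ)) := by
    have h : ∀ θ : ℝ, cosh (2 * ρ₀) - cos (θ - -ω) ≠ 0 := fun θ =>
      (cosh_sub_cos_pos (by positivity) _).ne'
    fun_prop (disch := exact h _)
  refine ⟨(hcont.intervalIntegrable _ _).congr_ae (ae_restrict_of_ae hae), ?_⟩
  rw [npOperator, curveIntegral, ← intervalIntegral.integral_congr_ae (hae.mono fun _ h _ => h),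
    intervalIntegral.integral_const_mul, integral_poisson_mul_cos (by positivity) _ n hn, hφ]
  have h2 := (Xi_pos hR hρ ω).ne'
  have h3 := hlam ω
  field_simp
  field_simp at h3
  linear_combination h3

theorem log_norm_ellipticPoint_sub {R₀ ρ ρ₀ ω θ : ℝ} (hR : 0 < R₀) (hρ : 0 ≤ ρ) (hρ₀ : 0 < ρ₀)
    (hθ : cos (θ - ω) ≠ 1) :
    log ‖ellipticPoint R₀ ρ ω - ellipticPoint R₀ ρ₀ θ‖ =
      log R₀ + 1 / 2 * log (cosh (ρ - ρ₀) - cos (θ - ω)) +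
        1 / 2 * log (cosh (ρ + ρ₀) - cos (θ - -ω)) := by
  have h1 : 0 < cosh (ρ - ρ₀) - cos (θ - ω) := by
    have := lt_of_le_of_ne (Real.cos_le_one _) hθ
    linarith [Real.one_le_cosh (ρ - ρ₀)]
  have h2 : 0 < cosh (ρ + ρ₀) - cos (θ - -ω) := cosh_sub_cos_pos (by positivity) _
  have h := congrArg log (norm_ellipticPoint_sub_sq R₀ ρ ρ₀ ω θ)
  rw [Real.log_pow, Real.log_mul (by positivity) (by positivity), Real.log_pow,
    Real.log_mul h1.ne' h2.ne'] at h
  push_cast at h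
  linarith

theorem singleLayerIntegrand_mul_norm_deriv {R₀ ρ ρ₀ : ℝ} (hR : 0 < R₀) (hρ : 0 ≤ ρ)
    (hρ₀ : 0 < ρ₀) {φ : Plane → ℝ} {n : ℕ} {δ : ℝ}
    (hφ : ∀ t, φ (ellipticPoint R₀ ρ₀ t) = (Xi R₀ ρ₀ t)⁻¹ * cos (n * t - δ)) {ω θ : ℝ}
    (hθ : cos (θ - ω) ≠ 1) :
    singleLayerIntegrand φ (ellipticPoint R₀ ρ ω) (ellipticPoint R₀ ρ₀ θ) *
      ‖deriv (ellipticPoint R₀ ρ₀) θ‖ = 1 / (2 * π) * (log R₀ * cos (n * θ - δ) +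
        1 / 2 * (log (cosh (ρ - ρ₀) - cos (θ - ω)) * cos (n * θ - δ)) +
        1 / 2 * (log (cosh (ρ + ρ₀) - cos (θ - -ω)) * cos (n * θ - δ))) := by
  have h1 := (Xi_pos hR hρ₀ θ).ne'
  rw [singleLayerIntegrand, fundamentalSolution, hφ, norm_deriv_ellipticPoint hR,
    log_norm_ellipticPoint_sub hR hρ hρ₀ hθ]
  field_simp

theorem singleLayer_ellipticPoint {R₀ ρ ρ₀ : ℝ} (hR : 0 < R₀) (hρ : 0 ≤ ρ)
    (hρ₀ : 0 < ρ₀) {φ : Plane → ℝ} {n : ℕ} (hn : 1 ≤ n) {δ : ℝ}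
    (hφ : ∀ t, φ (ellipticPoint R₀ ρ₀ t) = (Xi R₀ ρ₀ t)⁻¹ * cos (n * t - δ)) (ω : ℝ) :
    CurveIntegrable (ellipticPoint R₀ ρ₀) (singleLayerIntegrand φ (ellipticPoint R₀ ρ ω)) ∧
    singleLayer (ellipticPoint R₀ ρ₀) φ (ellipticPoint R₀ ρ ω) =
      -(1 / (2 * n)) * (exp (-(n * |ρ - ρ₀|)) * cos (n * ω - δ) +
        exp (-(n * (ρ + ρ₀))) * cos (n * ω + δ)) := by
  have hae : ∀ᵐ θ : ℝ, 1 / (2 * π) * (log R₀ * cos (n * θ - δ) +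
        1 / 2 * (log (cosh (ρ - ρ₀) - cos (θ - ω)) * cos (n * θ - δ)) +
        1 / 2 * (log (cosh (ρ + ρ₀) - cos (θ - -ω)) * cos (n * θ - δ))) =
      singleLayerIntegrand φ (ellipticPoint R₀ ρ ω) (ellipticPoint R₀ ρ₀ θ) *
        ‖deriv (ellipticPoint R₀ ρ₀) θ‖ := by
    filter_upwards [ae_cos_sub_ne_one ω] with θ hθ
    exact (singleLayerIntegrand_mul_norm_deriv hR hρ hρ₀ hφ hθ).symm
  have hcos : Continuous fun θ : ℝ => cos (n * θ - δ) := by fun_prop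
  have i1 : IntervalIntegrable (fun θ : ℝ => log R₀ * cos (n * θ - δ)) volume 0 (2 * π) :=
    (hcos.const_mul _).intervalIntegrable _ _
  have i2 (σ η : ℝ) : IntervalIntegrable
      (fun θ : ℝ => 1 / 2 * (log (cosh σ - cos (θ - η)) * cos (n * θ - δ))) volume 0 (2 * π) :=
    ((intervalIntegrable_log_cosh_sub_cos σ η _ _).mul_continuousOn hcos.continuousOn).const_mul _
  refine ⟨(((i1.add (i2 _ ω)).add (i2 _ (-ω))).const_mul _).congr_ae (ae_restrict_of_ae hae), ?_⟩
  have i0 : ∫ θ in (0 : ℝ)..(2 * π), cos (n * θ - δ) = 0 := by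
    simpa [sub_eq_add_neg] using integral_cos_int_mul_add n (by omega) (-δ)
  rw [singleLayer, curveIntegral, ← intervalIntegral.integral_congr_ae (hae.mono fun _ h _ => h),
    intervalIntegral.integral_const_mul, intervalIntegral.integral_add (i1.add (i2 _ ω)) (i2 _ (-ω)),
    intervalIntegral.integral_add i1 (i2 _ ω), intervalIntegral.integral_const_mul,
    intervalIntegral.integral_const_mul, intervalIntegral.integral_const_mul,
    integral_log_mul_cos _ _ n hn, integral_log_mul_cos _ _ n hn, i0,
    abs_of_pos (show 0 < ρ + ρ₀ by positivity)]
  have : cos (n * -ω - δ) = cos (n * ω + δ) := by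
    rw [← Real.cos_neg]
    ring_nf
  rw [this]
  have hn' : (n : ℝ) ≠ 0 := by positivity
  field_simp
  ring

/-! ### Elliptic coordinates on the whole plane and radial monotonicity -/

/-- Surjectivity of the complex cosine; its evenness allows the sign of the imaginary part to be
chosen so that `ρ ≥ 0`. -/
theorem exists_ellipticPoint_eq {R₀ : ℝ} (hR : 0 < R₀) (x : Plane) :
    ∃ ρ ω : ℝ, 0 ≤ ρ ∧ x = ellipticPoint R₀ ρ ω := by
  obtain ⟨w, hw⟩ := Complex.cos_surjective ⟨x 0 / R₀, x 1 / R₀⟩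
  rw [Complex.cos_eq, ← Complex.ofReal_cos, ← Complex.ofReal_sin, ← Complex.ofReal_cosh,
    ← Complex.ofReal_sinh] at hw
  have h0 := congrArg Complex.re hw
  have h1 := congrArg Complex.im hw
  simp [-Complex.ofReal_cos, -Complex.ofReal_sin, -Complex.ofReal_cosh, -Complex.ofReal_sinh] at h0 h1
  rw [eq_div_iff hR.ne'] at h0 h1
  rcases le_total 0 w.im with h | h
  · refine ⟨w.im, -w.re, h, ?_⟩
    ext i
    fin_cases i
    · simp [ellipticPoint]; linarith
    · simp [ellipticPoint]; linarith
  · refine ⟨-w.im, w.re, by linarith, ?_⟩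
    ext i
    fin_cases i
    · simp [ellipticPoint]; linarith
    · simp [ellipticPoint]; linarith

/-- Radial monotonicity towards the ellipse `ρ = ρ₀`. -/
theorem exp_neg_abs_add_exp_neg_le {m ρ ρ₀ : ℝ} (hm : 0 ≤ m) (hρ : 0 ≤ ρ) (hρ₀ : 0 ≤ ρ₀) :
    exp (-(m * |ρ - ρ₀|)) + exp (-(m * (ρ + ρ₀))) ≤ 1 + exp (-(m * (ρ₀ + ρ₀))) := by
  rcases le_total ρ ρ₀ with h | h
  · rw [abs_of_nonpos (by linarith)]
    -- Inside the ellipse the sum equals `2 exp (-mρ₀) cosh (mρ)`, increasing in `ρ`; outside, each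
    -- exponential is bounded separately.
    have hc : cosh (m * ρ) ≤ cosh (m * ρ₀) := by
      rw [Real.cosh_le_cosh, abs_of_nonneg (by positivity), abs_of_nonneg (by positivity)]
      gcongr
    have h0 (r : ℝ) : exp (-(m * -(r - ρ₀))) + exp (-(m * (r + ρ₀))) =
        2 * exp (-(m * ρ₀)) * cosh (m * r) := by
      have e1 : -(m * -(r - ρ₀)) = -(m * ρ₀) + m * r := by ring
      have e2 : -(m * (r + ρ₀)) = -(m * ρ₀) + -(m * r) := by ring
      rw [e1, e2, Real.exp_add, Real.exp_add, Real.cosh_eq]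
      ring
    have h1 := h0 ρ₀
    simp only [sub_self, neg_zero, mul_zero, Real.exp_zero] at h1
    rw [h0, h1]
    gcongr
  · gcongr
    exact Real.exp_le_one_iff.2 (by have := mul_nonneg hm (abs_nonneg (ρ - ρ₀)); linarith)

/-! ### The two families of densities -/

theorem phi1_eq_phase {R₀ ρ₀ : ℝ} (hR : 0 < R₀) (hρ : 0 < ρ₀) (n : ℕ) (t : ℝ) :
    phi1 R₀ ρ₀ n (ellipticPoint R₀ ρ₀ t) = (Xi R₀ ρ₀ t)⁻¹ * cos (n * t - 0) := by
  rw [phi1_ellipticPoint hR hρ, sub_zero]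

theorem phi2_eq_phase {R₀ ρ₀ : ℝ} (hR : 0 < R₀) (hρ : 0 < ρ₀) (n : ℕ) (t : ℝ) :
    phi2 R₀ ρ₀ n (ellipticPoint R₀ ρ₀ t) = (Xi R₀ ρ₀ t)⁻¹ * cos (n * t - π / 2) := by
  rw [phi2_ellipticPoint hR hρ, Real.cos_sub_pi_div_two]

theorem npEigenEquation_phi1 {R₀ ρ₀ : ℝ} (hR : 0 < R₀) (hρ : 0 < ρ₀) {n : ℕ} (hn : 1 ≤ n) :
    NPEigenEquation (ellipticPoint R₀ ρ₀) (phi1 R₀ ρ₀ n) (1 / (2 * exp (2 * n * ρ₀))) := by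
  refine npEigenEquation_of_eq hR hρ hn (phi1_eq_phase hR hρ n) fun t => ?_
  rw [Real.exp_neg, sub_zero, sub_zero, mul_neg, Real.cos_neg,
    show (n : ℝ) * (2 * ρ₀) = 2 * n * ρ₀ by ring]
  field_simp

theorem npEigenEquation_phi2 {R₀ ρ₀ : ℝ} (hR : 0 < R₀) (hρ : 0 < ρ₀) {n : ℕ} (hn : 1 ≤ n) :
    NPEigenEquation (ellipticPoint R₀ ρ₀) (phi2 R₀ ρ₀ n) (-(1 / (2 * exp (2 * n * ρ₀)))) := by
  refine npEigenEquation_of_eq hR hρ hn (phi2_eq_phase hR hρ n) fun t => ?_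
  rw [Real.exp_neg, Real.cos_sub_pi_div_two, Real.cos_sub_pi_div_two, mul_neg, Real.sin_neg,
    show (n : ℝ) * (2 * ρ₀) = 2 * n * ρ₀ by ring]
  field_simp

/-! ### Maxima of the densities and of their tangential derivatives -/

theorem abs_phi1_of_sin_eq_zero {R₀ ρ₀ ω : ℝ} (hR : 0 < R₀) (hρ : 0 < ρ₀) (n : ℕ)
    (hω : sin ω = 0) : |phi1 R₀ ρ₀ n (ellipticPoint R₀ ρ₀ ω)| = tauMax R₀ ρ₀ := by
  have hs := Real.sinh_pos_iff.2 hρ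
  rw [phi1_ellipticPoint hR hρ, abs_mul, abs_cos_nat_mul_of_sin_eq_zero hω,
    Xi_eq_of_sin_eq_zero hρ hω, tauMax, abs_of_pos (by positivity), mul_one, one_div]

theorem isMaxOn_abs_phi1 {R₀ ρ₀ ω : ℝ} (hR : 0 < R₀) (hρ : 0 < ρ₀) (n : ℕ) (hω : sin ω = 0) :
    IsMaxOn (fun x => |phi1 R₀ ρ₀ n x|) (ellipse R₀ ρ₀) (ellipticPoint R₀ ρ₀ ω) := by
  rintro x ⟨t, -, -, rfl⟩
  have hs := Real.sinh_pos_iff.2 hρ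
  have hX := Xi_pos hR hρ t
  have hle := le_Xi (ρ₀ := ρ₀) hR t
  change |phi1 R₀ ρ₀ n _| ≤ |phi1 R₀ ρ₀ n _|
  rw [abs_phi1_of_sin_eq_zero hR hρ n hω, phi1_ellipticPoint hR hρ, abs_mul,
    abs_of_pos (inv_pos.2 hX), tauMax, one_div]
  calc (Xi R₀ ρ₀ t)⁻¹ * |cos (n * t)| ≤ (R₀ * sinh ρ₀)⁻¹ * 1 := by
        gcongr
        exact Real.abs_cos_le_one _
    _ = (R₀ * sinh ρ₀)⁻¹ := mul_one _

theorem hasDerivAt_Xi {R₀ ρ₀ : ℝ} (hR : 0 < R₀) (hρ : 0 < ρ₀) (ω : ℝ) :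
    HasDerivAt (Xi R₀ ρ₀) (R₀ ^ 2 * (sin ω * cos ω) / Xi R₀ ρ₀ ω) ω := by
  have hs := Real.sinh_pos_iff.2 hρ
  have h1 : HasDerivAt (fun ω => sinh ρ₀ ^ 2 + sin ω ^ 2) (2 * sin ω * cos ω) ω := by
    simpa using ((Real.hasDerivAt_sin ω).pow 2).const_add (sinh ρ₀ ^ 2)
  have h2 := (h1.sqrt (by positivity)).const_mul R₀
  refine h2.congr_deriv ?_
  have h3 : 0 < √(sinh ρ₀ ^ 2 + sin ω ^ 2) := Real.sqrt_pos.2 (by positivity)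
  rw [Xi]
  field_simp

theorem hasDerivAt_phi2 {R₀ ρ₀ : ℝ} (hR : 0 < R₀) (hρ : 0 < ρ₀) (n : ℕ) (ω : ℝ) :
    HasDerivAt (fun ω => phi2 R₀ ρ₀ n (ellipticPoint R₀ ρ₀ ω))
      (R₀ ^ 2 * (n * cos (n * ω) * (sinh ρ₀ ^ 2 + sin ω ^ 2) - sin (n * ω) * (sin ω * cos ω)) /
        Xi R₀ ρ₀ ω ^ 3) ω := by
  have hX := (Xi_pos hR hρ ω).ne'
  have h1 : HasDerivAt (fun ω : ℝ => sin (n * ω)) (cos (n * ω) * n) ω := by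
    simpa using (((hasDerivAt_id ω).const_mul (n : ℝ))).sin
  simp_rw [phi2_ellipticPoint hR hρ]
  refine (((hasDerivAt_Xi hR hρ ω).inv hX).mul h1).congr_deriv ?_
  rw [Pi.inv_apply]
  field_simp
  rw [Xi_sq]
  ring

theorem tangentialDeriv_phi2 {R₀ ρ₀ : ℝ} (hR : 0 < R₀) (hρ : 0 < ρ₀) (n : ℕ) (ω : ℝ) :
    tangentialDeriv (ellipticPoint R₀ ρ₀) (phi2 R₀ ρ₀ n) ω =
      (n * cos (n * ω) * (sinh ρ₀ ^ 2 + sin ω ^ 2) - sin (n * ω) * (sin ω * cos ω)) /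
        (R₀ ^ 2 * (sinh ρ₀ ^ 2 + sin ω ^ 2) ^ 2) := by
  have hs := Real.sinh_pos_iff.2 hρ
  have hX := (Xi_pos hR hρ ω).ne'
  rw [tangentialDeriv, (hasDerivAt_phi2 hR hρ n ω).deriv, norm_deriv_ellipticPoint hR, div_div,
    show Xi R₀ ρ₀ ω ^ 3 * Xi R₀ ρ₀ ω = (Xi R₀ ρ₀ ω ^ 2) ^ 2 by ring, Xi_sq]
  have : 0 < sinh ρ₀ ^ 2 + sin ω ^ 2 := by positivity
  field_simp

theorem abs_tangentialDeriv_phi2_of_sin_eq_zero {R₀ ρ₀ ω : ℝ} (hR : 0 < R₀) (hρ : 0 < ρ₀) (n : ℕ)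
    (hω : sin ω = 0) :
    |tangentialDeriv (ellipticPoint R₀ ρ₀) (phi2 R₀ ρ₀ n) ω| = tauMax' R₀ ρ₀ n := by
  have hs := Real.sinh_pos_iff.2 hρ
  rw [tangentialDeriv_phi2 hR hρ, hω, tauMax', abs_div, zero_mul, mul_zero, sub_zero,
    zero_pow two_ne_zero, add_zero, abs_mul, abs_mul, abs_cos_nat_mul_of_sin_eq_zero hω,
    Nat.abs_cast, abs_of_pos (show 0 < sinh ρ₀ ^ 2 by positivity), abs_of_pos (by positivity)]
  field_simp

theorem isMaxOn_abs_tangentialDeriv_phi2 {R₀ ρ₀ ω : ℝ} (hR : 0 < R₀) (hρ : 0 < ρ₀) (n : ℕ)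
    (hω : sin ω = 0) :
    IsMaxOn (fun ω => |tangentialDeriv (ellipticPoint R₀ ρ₀) (phi2 R₀ ρ₀ n) ω|) univ ω := by
  intro t _
  change |tangentialDeriv _ _ t| ≤ |tangentialDeriv _ _ ω|
  have hs := Real.sinh_pos_iff.2 hρ
  have hA : 0 < sinh ρ₀ ^ 2 := by positivity
  have hB : 0 ≤ sin t ^ 2 := sq_nonneg _
  rw [abs_tangentialDeriv_phi2_of_sin_eq_zero hR hρ n hω, tangentialDeriv_phi2 hR hρ, abs_div,
    abs_of_pos (show 0 < R₀ ^ 2 * (sinh ρ₀ ^ 2 + sin t ^ 2) ^ 2 by positivity), tauMax',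
    div_le_div_iff₀ (by positivity) (by positivity)]
  have h1 : |n * cos (n * t) * (sinh ρ₀ ^ 2 + sin t ^ 2) - sin (n * t) * (sin t * cos t)| ≤
      n * (sinh ρ₀ ^ 2 + 2 * sin t ^ 2) := by
    refine (abs_sub _ _).trans ?_
    rw [abs_mul, abs_mul, abs_mul, abs_mul (sin t), Nat.abs_cast,
      abs_of_pos (show 0 < sinh ρ₀ ^ 2 + sin t ^ 2 by positivity)]
    calc n * |cos (n * t)| * (sinh ρ₀ ^ 2 + sin t ^ 2) + |sin (n * t)| * (|sin t| * |cos t|)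
        ≤ n * 1 * (sinh ρ₀ ^ 2 + sin t ^ 2) + n * |sin t| * (|sin t| * 1) := by
          gcongr
          · exact Real.abs_cos_le_one _
          · exact abs_sin_nat_mul_le n t
          · exact Real.abs_cos_le_one _
      _ = n * (sinh ρ₀ ^ 2 + sin t ^ 2) + n * |sin t| ^ 2 := by ring
      _ = n * (sinh ρ₀ ^ 2 + 2 * sin t ^ 2) := by rw [sq_abs]; ring
  calc _ ≤ n * (sinh ρ₀ ^ 2 + 2 * sin t ^ 2) * (R₀ ^ 2 * sinh ρ₀ ^ 2) := by gcongr
    _ = n * R₀ ^ 2 * ((sinh ρ₀ ^ 2 + 2 * sin t ^ 2) * sinh ρ₀ ^ 2) := by ring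
    -- With `A = sinh² ρ₀` and `B = sin² t`, this is `(A + 2B) A = (A + B)² - B²`.
    _ ≤ n * R₀ ^ 2 * (sinh ρ₀ ^ 2 + sin t ^ 2) ^ 2 := by
        gcongr
        nlinarith [sq_nonneg (sin t ^ 2)]
    _ = n * (R₀ ^ 2 * (sinh ρ₀ ^ 2 + sin t ^ 2) ^ 2) := by ring

/-! ### Maxima of the single-layer potentials -/

theorem curveIntegrable_singleLayerIntegrand {R₀ ρ₀ : ℝ} (hR : 0 < R₀) (hρ₀ : 0 < ρ₀)
    {φ : Plane → ℝ} {n : ℕ} (hn : 1 ≤ n) {δ : ℝ}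
    (hφ : ∀ t, φ (ellipticPoint R₀ ρ₀ t) = (Xi R₀ ρ₀ t)⁻¹ * cos (n * t - δ)) (x : Plane) :
    CurveIntegrable (ellipticPoint R₀ ρ₀) (singleLayerIntegrand φ x) := by
  obtain ⟨ρ, ω, hρ, rfl⟩ := exists_ellipticPoint_eq hR x
  exact (singleLayer_ellipticPoint hR hρ hρ₀ hn hφ ω).1

theorem abs_singleLayer_phi1 {R₀ ρ ρ₀ : ℝ} (hR : 0 < R₀) (hρ : 0 ≤ ρ) (hρ₀ : 0 < ρ₀) {n : ℕ}
    (hn : 1 ≤ n) (ω : ℝ) :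
    |singleLayer (ellipticPoint R₀ ρ₀) (phi1 R₀ ρ₀ n) (ellipticPoint R₀ ρ ω)| =
      1 / (2 * n) * (exp (-(n * |ρ - ρ₀|)) + exp (-(n * (ρ + ρ₀)))) * |cos (n * ω)| := by
  rw [(singleLayer_ellipticPoint hR hρ hρ₀ hn (phi1_eq_phase hR hρ₀ n) ω).2, sub_zero, add_zero,
    ← add_mul, ← mul_assoc, abs_mul, neg_mul, abs_neg, abs_of_nonneg (by positivity)]

theorem isMaxOn_abs_singleLayer_phi1 {R₀ ρ₀ ω : ℝ} (hR : 0 < R₀) (hρ₀ : 0 < ρ₀) {n : ℕ}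
    (hn : 1 ≤ n) (hω : sin ω = 0) :
    IsMaxOn (fun x => |singleLayer (ellipticPoint R₀ ρ₀) (phi1 R₀ ρ₀ n) x|) univ
      (ellipticPoint R₀ ρ₀ ω) := by
  intro x _
  obtain ⟨ρ, t, hρ, rfl⟩ := exists_ellipticPoint_eq hR x
  change |singleLayer _ _ _| ≤ |singleLayer _ _ _|
  rw [abs_singleLayer_phi1 hR hρ hρ₀ hn, abs_singleLayer_phi1 hR hρ₀.le hρ₀ hn,
    abs_cos_nat_mul_of_sin_eq_zero hω, sub_self, abs_zero, mul_zero, neg_zero, Real.exp_zero]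
  have h := exp_neg_abs_add_exp_neg_le n.cast_nonneg hρ hρ₀.le
  gcongr
  exact Real.abs_cos_le_one _

theorem singleLayer_phi2 {R₀ ρ₀ : ℝ} (hR : 0 < R₀) (hρ₀ : 0 < ρ₀) {n : ℕ} (hn : 1 ≤ n) (ω : ℝ) :
    singleLayer (ellipticPoint R₀ ρ₀) (phi2 R₀ ρ₀ n) (ellipticPoint R₀ ρ₀ ω) =
      -(1 / (2 * n)) * (1 - exp (-(n * (ρ₀ + ρ₀)))) * sin (n * ω) := by
  rw [(singleLayer_ellipticPoint hR hρ₀.le hρ₀ hn (phi2_eq_phase hR hρ₀ n) ω).2, sub_self,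
    abs_zero, mul_zero, neg_zero, Real.exp_zero, Real.cos_sub_pi_div_two, Real.cos_add_pi_div_two]
  ring

theorem hasDerivAt_singleLayer_phi2 {R₀ ρ₀ : ℝ} (hR : 0 < R₀) (hρ₀ : 0 < ρ₀) {n : ℕ} (hn : 1 ≤ n)
    (ω : ℝ) :
    HasDerivAt (fun ω => singleLayer (ellipticPoint R₀ ρ₀) (phi2 R₀ ρ₀ n) (ellipticPoint R₀ ρ₀ ω))
      (-(1 / (2 * n)) * (1 - exp (-(n * (ρ₀ + ρ₀)))) * (cos (n * ω) * n)) ω := by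
  have h1 : HasDerivAt (fun ω : ℝ => sin (n * ω)) (cos (n * ω) * n) ω := by
    simpa using (((hasDerivAt_id ω).const_mul (n : ℝ))).sin
  simp_rw [singleLayer_phi2 hR hρ₀ hn]
  exact h1.const_mul _

/-- On the ellipse the potential is a constant multiple of `sin nω`, so its tangential derivative is
a constant multiple of `cos nω / Ξ`: at a vertex the numerator is largest in modulus and the
denominator smallest. -/
theorem isMaxOn_abs_tangentialDeriv_singleLayer_phi2 {R₀ ρ₀ ω : ℝ} (hR : 0 < R₀) (hρ₀ : 0 < ρ₀)
    {n : ℕ} (hn : 1 ≤ n) (hω : sin ω = 0) :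
    IsMaxOn (fun ω => |tangentialDeriv (ellipticPoint R₀ ρ₀)
      (singleLayer (ellipticPoint R₀ ρ₀) (phi2 R₀ ρ₀ n)) ω|) univ ω := by
  intro t _
  change |tangentialDeriv _ _ t| ≤ |tangentialDeriv _ _ ω|
  have hs := Real.sinh_pos_iff.2 hρ₀
  have hX := Xi_pos hR hρ₀ t
  have hle := le_Xi (ρ₀ := ρ₀) hR t
  rw [tangentialDeriv, tangentialDeriv, (hasDerivAt_singleLayer_phi2 hR hρ₀ hn t).deriv,
    (hasDerivAt_singleLayer_phi2 hR hρ₀ hn ω).deriv, norm_deriv_ellipticPoint hR,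
    norm_deriv_ellipticPoint hR, Xi_eq_of_sin_eq_zero hρ₀ hω, abs_div, abs_div,
    abs_of_pos hX, abs_of_pos (show 0 < R₀ * sinh ρ₀ by positivity)]
  simp only [abs_mul, abs_cos_nat_mul_of_sin_eq_zero hω]
  gcongr
  exact Real.abs_cos_le_one _

end EllipseNP

theorem mainTheorem1 (R₀ : ℝ) (hR₀ : 0 < R₀) :
    -- for each ellipse and each `n ≥ 1`
    (∀ ρ₀ : ℝ, 0 < ρ₀ → ∀ n : ℕ, 1 ≤ n →
      -- the densities satisfy the Neumann–Poincaré eigenvalue equation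
      (EllipseNP.NPEigenEquation (EllipseNP.ellipticPoint R₀ ρ₀) (EllipseNP.phi1 R₀ ρ₀ n)
          (1 / (2 * Real.exp (2 * n * ρ₀))) ∧
        EllipseNP.NPEigenEquation (EllipseNP.ellipticPoint R₀ ρ₀) (EllipseNP.phi2 R₀ ρ₀ n)
          (-(1 / (2 * Real.exp (2 * n * ρ₀))))) ∧
      -- the maximum of `|φ_{1,n}|` on the ellipse
      (IsMaxOn (fun x => |EllipseNP.phi1 R₀ ρ₀ n x|) (EllipseNP.ellipse R₀ ρ₀)
          (EllipseNP.leftVertex R₀ ρ₀) ∧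
        IsMaxOn (fun x => |EllipseNP.phi1 R₀ ρ₀ n x|) (EllipseNP.ellipse R₀ ρ₀)
          (EllipseNP.rightVertex R₀ ρ₀) ∧
        |EllipseNP.phi1 R₀ ρ₀ n (EllipseNP.leftVertex R₀ ρ₀)| = EllipseNP.tauMax R₀ ρ₀ ∧
        |EllipseNP.phi1 R₀ ρ₀ n (EllipseNP.rightVertex R₀ ρ₀)| = EllipseNP.tauMax R₀ ρ₀) ∧
      -- the maximum of `|dφ_{2,n}|` on the ellipse (vertices at `ω = π` and `ω = 0`)
      (Differentiable ℝ (fun ω => EllipseNP.phi2 R₀ ρ₀ n (EllipseNP.ellipticPoint R₀ ρ₀ ω)) ∧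
        IsMaxOn (fun ω => |EllipseNP.tangentialDeriv (EllipseNP.ellipticPoint R₀ ρ₀)
          (EllipseNP.phi2 R₀ ρ₀ n) ω|) Set.univ Real.pi ∧
        IsMaxOn (fun ω => |EllipseNP.tangentialDeriv (EllipseNP.ellipticPoint R₀ ρ₀)
          (EllipseNP.phi2 R₀ ρ₀ n) ω|) Set.univ 0 ∧
        |EllipseNP.tangentialDeriv (EllipseNP.ellipticPoint R₀ ρ₀)
          (EllipseNP.phi2 R₀ ρ₀ n) Real.pi| = EllipseNP.tauMax' R₀ ρ₀ n ∧
        |EllipseNP.tangentialDeriv (EllipseNP.ellipticPoint R₀ ρ₀)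
          (EllipseNP.phi2 R₀ ρ₀ n) 0| = EllipseNP.tauMax' R₀ ρ₀ n) ∧
      -- the maximum of `|S[φ_{1,n}]|`, over the whole plane
      ((∀ x, EllipseNP.CurveIntegrable (EllipseNP.ellipticPoint R₀ ρ₀)
          (EllipseNP.singleLayerIntegrand (EllipseNP.phi1 R₀ ρ₀ n) x)) ∧
        IsMaxOn (fun x => |EllipseNP.singleLayer (EllipseNP.ellipticPoint R₀ ρ₀)
          (EllipseNP.phi1 R₀ ρ₀ n) x|) Set.univ (EllipseNP.leftVertex R₀ ρ₀) ∧
        IsMaxOn (fun x => |EllipseNP.singleLayer (EllipseNP.ellipticPoint R₀ ρ₀)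
          (EllipseNP.phi1 R₀ ρ₀ n) x|) Set.univ (EllipseNP.rightVertex R₀ ρ₀)) ∧
      -- the maximum of `|dS[φ_{2,n}]|` on the ellipse
      ((∀ x, EllipseNP.CurveIntegrable (EllipseNP.ellipticPoint R₀ ρ₀)
          (EllipseNP.singleLayerIntegrand (EllipseNP.phi2 R₀ ρ₀ n) x)) ∧
        Differentiable ℝ (fun ω => EllipseNP.singleLayer (EllipseNP.ellipticPoint R₀ ρ₀)
          (EllipseNP.phi2 R₀ ρ₀ n) (EllipseNP.ellipticPoint R₀ ρ₀ ω)) ∧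
        IsMaxOn (fun ω => |EllipseNP.tangentialDeriv (EllipseNP.ellipticPoint R₀ ρ₀)
          (EllipseNP.singleLayer (EllipseNP.ellipticPoint R₀ ρ₀) (EllipseNP.phi2 R₀ ρ₀ n)) ω|)
          Set.univ Real.pi ∧
        IsMaxOn (fun ω => |EllipseNP.tangentialDeriv (EllipseNP.ellipticPoint R₀ ρ₀)
          (EllipseNP.singleLayer (EllipseNP.ellipticPoint R₀ ρ₀) (EllipseNP.phi2 R₀ ρ₀ n)) ω|)
          Set.univ 0)) ∧
    -- the largest curvature is attained at the two vertices, with the stated value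
    (∀ ρ₀ : ℝ, 0 < ρ₀ →
      IsMaxOn (EllipseNP.curvature (EllipseNP.ellipticPoint R₀ ρ₀)) Set.univ Real.pi ∧
      IsMaxOn (EllipseNP.curvature (EllipseNP.ellipticPoint R₀ ρ₀)) Set.univ 0 ∧
      EllipseNP.curvature (EllipseNP.ellipticPoint R₀ ρ₀) Real.pi = EllipseNP.kappaMax R₀ ρ₀ ∧
      EllipseNP.curvature (EllipseNP.ellipticPoint R₀ ρ₀) 0 = EllipseNP.kappaMax R₀ ρ₀ ∧
      EllipseNP.kappaMax R₀ ρ₀ = Real.cosh ρ₀ / (R₀ * Real.sinh ρ₀ ^ 2)) ∧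
    -- the asymptotics as `κ_max → +∞`, equivalently `ρ₀ → 0+`
    (EllipseNP.highCurvature R₀ = 𝓝[>] (0 : ℝ) ∧
      (∃ α : ℝ, 0 < α ∧
        EllipseNP.tauMax R₀ ~[EllipseNP.highCurvature R₀]
          fun ρ₀ => α * EllipseNP.kappaMax R₀ ρ₀ ^ (1 / 2 : ℝ)) ∧
      ∀ n : ℕ, 1 ≤ n →
        Tendsto (fun ρ₀ => EllipseNP.tauMax' R₀ ρ₀ n) (EllipseNP.highCurvature R₀) atTop) := by
  have hπ := Real.sin_pi
  have h0 := Real.sin_zero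
  refine ⟨fun ρ₀ hρ n hn => ⟨⟨?_, ?_⟩, ⟨?_, ?_, ?_, ?_⟩, ⟨?_, ?_, ?_, ?_, ?_⟩, ⟨?_, ?_, ?_⟩,
    ?_, ?_, ?_, ?_⟩, fun ρ₀ hρ => ⟨?_, ?_, ?_, ?_, ?_⟩, ?_⟩
  · exact EllipseNP.npEigenEquation_phi1 hR₀ hρ hn
  · exact EllipseNP.npEigenEquation_phi2 hR₀ hρ hn
  · exact EllipseNP.isMaxOn_abs_phi1 hR₀ hρ n hπ
  · exact EllipseNP.isMaxOn_abs_phi1 hR₀ hρ n h0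
  · exact EllipseNP.abs_phi1_of_sin_eq_zero hR₀ hρ n hπ
  · exact EllipseNP.abs_phi1_of_sin_eq_zero hR₀ hρ n h0
  · exact fun ω => (EllipseNP.hasDerivAt_phi2 hR₀ hρ n ω).differentiableAt
  · exact EllipseNP.isMaxOn_abs_tangentialDeriv_phi2 hR₀ hρ n hπ
  · exact EllipseNP.isMaxOn_abs_tangentialDeriv_phi2 hR₀ hρ n h0
  · exact EllipseNP.abs_tangentialDeriv_phi2_of_sin_eq_zero hR₀ hρ n hπ
  · exact EllipseNP.abs_tangentialDeriv_phi2_of_sin_eq_zero hR₀ hρ n h0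
  · exact EllipseNP.curveIntegrable_singleLayerIntegrand hR₀ hρ hn
      (EllipseNP.phi1_eq_phase hR₀ hρ n)
  · exact EllipseNP.isMaxOn_abs_singleLayer_phi1 hR₀ hρ hn hπ
  · exact EllipseNP.isMaxOn_abs_singleLayer_phi1 hR₀ hρ hn h0
  · exact EllipseNP.curveIntegrable_singleLayerIntegrand hR₀ hρ hn
      (EllipseNP.phi2_eq_phase hR₀ hρ n)
  · exact fun ω => (EllipseNP.hasDerivAt_singleLayer_phi2 hR₀ hρ hn ω).differentiableAt
  · exact EllipseNP.isMaxOn_abs_tangentialDeriv_singleLayer_phi2 hR₀ hρ hn hπ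
  · exact EllipseNP.isMaxOn_abs_tangentialDeriv_singleLayer_phi2 hR₀ hρ hn h0
  · exact EllipseNP.isMaxOn_curvature hR₀ hρ hπ
  · exact EllipseNP.isMaxOn_curvature hR₀ hρ h0
  · exact EllipseNP.curvature_eq_kappaMax hR₀ hρ hπ
  · exact EllipseNP.curvature_eq_kappaMax hR₀ hρ h0
  · exact EllipseNP.kappaMax_eq hR₀ hρ
  · rw [EllipseNP.highCurvature_eq hR₀]
    exact ⟨rfl, ⟨_, inv_pos.2 (Real.sqrt_pos.2 hR₀), EllipseNP.tauMax_isEquivalent hR₀⟩,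
      fun n hn => EllipseNP.tendsto_const_div_mul_sinh_sq hR₀ (Nat.cast_pos.2 hn)⟩
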